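/- Let $q$ be a prime power and $\alpha\in\mathbb F_{q^m}$ an element of degree $m$ over $\mathbb F_q$. For $j\ge 1$ put $\mathcal V_{\alpha,j}=\langle 1,\alpha,\dots,\alpha^{j-1}\rangle_{\mathbb F_q}$; for $\mathbb F_q$-subspaces $\mathcal A,\mathcal B$ of $\mathbb F_{q^m}$ let $\mathcal A\mathcal B$ be the $\mathbb F_q$-span of all products $ab$, $a\in\mathcal A$, $b\in\mathcal B$. The support of a vector over $\mathbb F_{q^m}$ is the $\mathbb F_q$-span of its coordinates, and its rank is the dimension of its support. Let $d,k,n$ be positive integers with $k<n$, and let $\mathbf H=(h_{i,j})\in\mathbb F_{q^m}^{(n-k)\times n}$ have linearly independent rows and entries that span $\mathcal V_{\alpha,d}$ over $\mathbb F_q$. Write $h_{i,j}=\sum_{v=0}^{d-1}h_{i,j,v}\alpha^v$ with $h_{i,j,v}\in\mathbb F_q$, and let $\mathbf H_{ext}\in\mathbb F_q^{(n-k)d\times n}$ be the matrix with entry $h_{i,j,v}$ in row $(i,v)$ and column $j$. Assume the unique-decoding property ($d\ge n/(n-k)$ and the columns of $\mathbf H_{ext}$ are linearly independent) and the maximal-row-span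 property (every row of $\mathbf H$ spans $\mathcal V_{\alpha,d}$ over $\mathbb F_q$). Let $r,t$ be positive integers with $r(d+t-1)\le t(n-k)$ and $(d+t)r\le m$. Decoding algorithm. On input $\mathbf y\in\mathbb F_{q^m}^n$ compute $\mathbf s=(s_1,\dots,s_{n-k})=\mathbf y\mathbf H^{\intercal}$. If $\mathbf s=\mathbf 0$, return $\mathbf y$. Otherwise let $\mathcal S$ be the support of $\mathbf s$, put $\mathcal F_{d+t-1}=\mathcal V_{\alpha,t}\mathcal S$ and $\mathcal F_{j-1}=(\alpha^{-1}\mathcal F_j)\cap\mathcal F_j$ for $j=d+t-1,\dots,2$. If $\mathcal F_1=\{0\}$, fail. Otherwise choose a basis $\varepsilon_1,\dots,\varepsilon_\rho$ of $\mathcal F_1$ and $s_{i,u,v}\in\mathbb F_q$ with $s_i=\sum_{u=1}^{\rho}\sum_{v=0}^{d-1}s_{i,u,v}\varepsilon_u\alpha^v$ for all $i$ (fail if there are none); then choose $e_{j,u}\in\mathbb F_q$ with $\mathbf H_{ext}(e_{1,u},\dots,e_{n,u})^{\intercal}=(s_{i,u,v})_{(i,v)}$ for $u=1,\dots,\rho$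 (fail if there are none), and return $\mathbf y-\big(\sum_{u}e_{j,u}\varepsilon_u\big)_{1\le j\le n}$. The probability $P_t$. Let $\mathbf E'$ be a uniformly random matrix in $\mathbb F_q^{r\times n}$, and for $1\le v\le d$ put $\mathbf X_v=(h_{i,j,v-1})_{i,j}\,\mathbf E'^{\intercal}\in\mathbb F_q^{(n-k)\times r}$. Thus, for every $\boldsymbol\varepsilon\in\mathbb F_{q^m}^r$, the syndrome of $\mathbf e'=\boldsymbol\varepsilon\mathbf E'$ is given by $\mathbf H\mathbf e'^{\intercal}=\sum_{v=1}^{d}\alpha^{v-1}\mathbf X_v\boldsymbol\varepsilon^{\intercal}$. Let $\mathbf M_t$ be the $t(n-k)\times r(d+t-1)$ matrix over $\mathbb F_q$ with $t$ block rows and $d+t-1$ block columns whose $a$-th block row has $\mathbf X_1,\dots,\mathbf X_d$ in block columns $a,\dots,a+d-1$ and zeros elsewhere. Put $P_t=\Pr\big(\operatorname{rank}(\mathbf M_t)=r(d+t-1)\big)$. Then for every codeword $\mathbf c$ (that is, $\mathbf c\mathbf H^{\intercal}=\mathbf 0$), if $\mathbf e$ is uniformly distributed on the vectors of rank $r$ in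 $\mathbb F_{q^m}^n$, the algorithm with input $\mathbf y=\mathbf c+\mathbf e$ returns $\mathbf c$, whatever choices it makes, with probability at least $$\left(1-\frac{q^{r(t+d)}}{q^m-q^{r-1}}\right)P_t .$$ -/

import Mathlib

open scoped Matrix

namespace BDLRPC

noncomputable section

variable {F K : Type*} [Field F] [Field K] [Algebra F K]

/-- The support of a vector over `K`: the `F`-subspace of `K` spanned by its coordinates. -/
def supp {ι : Type*} (u : ι → K) : Submodule F K :=
  Submodule.span F (Set.range u)

/-- The rank of a vector over `K`: the `F`-dimension of its support. -/
def vecRank (F : Type*) {K : Type*} [Field F] [Field K] [Algebra F K] {ι : Type*}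
    (u : ι → K) : ℕ :=
  Module.finrank F (supp (F := F) u)

/-- The `F`-subspace of `K` generated by `1, α, …, α ^ (d - 1)`. -/
def boundedDegree (F : Type*) {K : Type*} [Field F] [Field K] [Algebra F K]
    (α : K) (d : ℕ) : Submodule F K :=
  Submodule.span F (Set.range fun v : Fin d => α ^ (v : ℕ))

/-- `H` is a parity-check matrix of a bounded-degree low-rank parity-check code: its entries span
`boundedDegree F α d` over `F` and its rows are linearly independent over `K`. -/
structure IsBDLRPC (F : Type*) {K : Type*} [Field F] [Field K] [Algebra F K] {l n : ℕ}
    (α : K) (d : ℕ) (H : Matrix (Fin l) (Fin n) K) : Prop where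
  span_entries :
    Submodule.span F (Set.range fun p : Fin l × Fin n => H p.1 p.2) = boundedDegree F α d
  rows_indep : LinearIndependent K H.row

/-- The code with parity-check matrix `H`. -/
def code {l n : ℕ} (H : Matrix (Fin l) (Fin n) K) : Submodule K (Fin n → K) :=
  LinearMap.ker H.mulVecLin

/-- `Hext` is the matrix of coefficients of the entries of `H` with respect to
`1, α, …, α ^ (d - 1)`; its row `(i, v)` holds the coefficients at `α ^ v` of row `i` of `H`. -/
def IsExpansion {l n d : ℕ} (α : K) (H : Matrix (Fin l) (Fin n) K)
    (Hext : Matrix (Fin l × Fin d) (Fin n) F) : Prop :=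
  ∀ i j, H i j = ∑ v : Fin d, Hext (i, v) j • α ^ (v : ℕ)

/-- The unique-decoding property, for a code of length `n` and dimension `n - l`. -/
structure UniqueDecoding {l n d : ℕ} (Hext : Matrix (Fin l × Fin d) (Fin n) F) : Prop where
  le_d : (n : ℚ) / (l : ℚ) ≤ (d : ℚ)
  cols_indep : LinearIndependent F Hext.col

/-- The maximal-row-span property: every row of `H` spans the whole of `boundedDegree F α d`. -/
def MaximalRowSpan (F : Type*) {K : Type*} [Field F] [Field K] [Algebra F K] {l n : ℕ}
    (α : K) (d : ℕ) (H : Matrix (Fin l) (Fin n) K) : Prop :=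
  ∀ i, supp (F := F) (H i) = boundedDegree F α d

/-! ### The decoding algorithm -/

/-- One intersection step `W ↦ (α⁻¹ W) ∩ W`. -/
def interStep (α : K) (W : Submodule F K) : Submodule F K :=
  W.map (LinearMap.mulLeft F α⁻¹) ⊓ W

/-- The support computed from a syndrome `s`: start from the expanded syndrome support
`boundedDegree F α t * supp s` (with index `d + t - 1`) and go down to index `1` by
`d + t - 2` intersection steps. -/
def recoveredSupport (F : Type*) {K : Type*} [Field F] [Field K] [Algebra F K] {l : ℕ}
    (α : K) (d t : ℕ) (s : Fin l → K) : Submodule F K :=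
  (interStep α)^[d + t - 2] (boundedDegree F α t * supp s)

/-- `σ i u v` are coefficients of the syndrome entries `s i` on the products `ε u * α ^ v`. -/
def IsSyndromeDecomposition {l d ρ : ℕ} (α : K) (s : Fin l → K) (ε : Fin ρ → K)
    (σ : Fin l → Fin ρ → Fin d → F) : Prop :=
  ∀ i, s i = ∑ u, ∑ v, σ i u v • (ε u * α ^ (v : ℕ))

/-- `x` solves the erasure equations `Hext * (column u of x) = (σ i u v)_(i, v)`, all `u`. -/
def IsErasureSolution {l n d ρ : ℕ} (Hext : Matrix (Fin l × Fin d) (Fin n) F)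
    (σ : Fin l → Fin ρ → Fin d → F) (x : Fin n → Fin ρ → F) : Prop :=
  ∀ u, Hext *ᵥ (fun j => x j u) = fun p => σ p.1 u p.2

/-- `Returns α H Hext t y o`: the decoding algorithm, run on the received word `y`, can return
`o`, where `none` is "decoding failure". The algorithm is free to choose a basis of the recovered
support and solutions of the two linear systems; every choice gives a possible output. -/
inductive Returns {l n d : ℕ} (α : K) (H : Matrix (Fin l) (Fin n) K)
    (Hext : Matrix (Fin l × Fin d) (Fin n) F) (t : ℕ) (y : Fin n → K) :
    Option (Fin n → K) → Prop
  | zero_syndrome (hs : H *ᵥ y = 0) : Returns α H Hext t y (some y)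
  | zero_support (hs : H *ᵥ y ≠ 0) (hE : recoveredSupport F α d t (H *ᵥ y) = ⊥) :
      Returns α H Hext t y none
  | no_decomposition (hs : H *ᵥ y ≠ 0) (hE : recoveredSupport F α d t (H *ᵥ y) ≠ ⊥)
      {ρ : ℕ} (ε : Module.Basis (Fin ρ) F (recoveredSupport F α d t (H *ᵥ y)))
      (hσ : ¬ ∃ σ : Fin l → Fin ρ → Fin d → F,
        IsSyndromeDecomposition α (H *ᵥ y) (fun u => (ε u : K)) σ) :
      Returns α H Hext t y none
  | no_erasure_solution (hs : H *ᵥ y ≠ 0) (hE : recoveredSupport F α d t (H *ᵥ y) ≠ ⊥)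
      {ρ : ℕ} (ε : Module.Basis (Fin ρ) F (recoveredSupport F α d t (H *ᵥ y)))
      (σ : Fin l → Fin ρ → Fin d → F)
      (hσ : IsSyndromeDecomposition α (H *ᵥ y) (fun u => (ε u : K)) σ)
      (hx : ¬ ∃ x : Fin n → Fin ρ → F, IsErasureSolution Hext σ x) :
      Returns α H Hext t y none
  | decoded (hs : H *ᵥ y ≠ 0) (hE : recoveredSupport F α d t (H *ᵥ y) ≠ ⊥)
      {ρ : ℕ} (ε : Module.Basis (Fin ρ) F (recoveredSupport F α d t (H *ᵥ y)))
      (σ : Fin l → Fin ρ → Fin d → F)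
      (hσ : IsSyndromeDecomposition α (H *ᵥ y) (fun u => (ε u : K)) σ)
      (x : Fin n → Fin ρ → F) (hx : IsErasureSolution Hext σ x) :
      Returns α H Hext t y (some (y - fun j => ∑ u, x j u • (ε u : K)))

/-- The algorithm, run on `y`, returns the word `c`, whatever choices it makes. -/
def Decodes {l n d : ℕ} (α : K) (H : Matrix (Fin l) (Fin n) K)
    (Hext : Matrix (Fin l × Fin d) (Fin n) F) (t : ℕ) (y c : Fin n → K) : Prop :=
  ∀ o, Returns α H Hext t y o ↔ o = some c

/-! ### Probabilities -/

/-- The probability that a uniformly random element of the finite set `S` lies in `A`. -/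
def prob {Ω : Type*} (S A : Set Ω) : ℝ :=
  ((S ∩ A).ncard : ℝ) / (S.ncard : ℝ)

/-- The block matrix with `t` block rows and `d + t - 1` block columns (counted from `0`), whose
block in position `(a, b)` is `X (b - a)` if `a ≤ b < a + d`, and zero otherwise. -/
def blockToeplitz {l r d : ℕ} (t : ℕ) (X : Fin d → Matrix (Fin l) (Fin r) F) :
    Matrix (Fin t × Fin l) (Fin (d + t - 1) × Fin r) F :=
  fun p c =>
    if h : (p.1 : ℕ) ≤ (c.1 : ℕ) ∧ (c.1 : ℕ) - (p.1 : ℕ) < d then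
      X ⟨(c.1 : ℕ) - (p.1 : ℕ), h.2⟩ p.2 c.2
    else 0

/-- The coefficient matrices of the syndrome of `e' = ε E'`: for `ε = (ε₁, …, ε_r)` one has
`H e'ᵀ = ∑ v, α ^ v • (syndromeCoeff Hext E' v) εᵀ`. -/
def syndromeCoeff {l n d r : ℕ} (Hext : Matrix (Fin l × Fin d) (Fin n) F)
    (E' : Matrix (Fin r) (Fin n) F) (v : Fin d) : Matrix (Fin l) (Fin r) F :=
  Matrix.of (fun i j => Hext (i, v) j) * E'ᵀ

/-- The probability `P_t` that, for a uniformly random `E' ∈ F ^ (r × n)`, the block matrix built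
from the coefficient matrices of the syndrome has full rank `r (d + t - 1)`. -/
def expansionProb {l n d : ℕ} (Hext : Matrix (Fin l × Fin d) (Fin n) F) (r t : ℕ) : ℝ :=
  prob (Set.univ : Set (Matrix (Fin r) (Fin n) F))
    {E' | (blockToeplitz t (syndromeCoeff Hext E')).rank = r * (d + t - 1)}

end

end BDLRPC

namespace BDLRPC

/-! Write the error as `e = ε E'`, where `ε` is a basis of its support and `E'` has entries in `F`.
Two separate conditions make decoding succeed: the products `α ^ b * ε u` with `b < d + t` are
linearly independent (a condition on `ε` alone), and the block matrix has full column rank (a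
condition on `E'` alone).

The block matrix expresses the products `α ^ a * s i` through the products `α ^ b * ε u` with `b < d
+ t - 1`. Full column rank gives a left inverse, so both families span the same space
(`boundedDegree_mul_supp`). By independence, each intersection step removes exactly the highest
power of `α` (`interStep_powSpan`), so the steps end at the span of `ε`. Then both linear systems
have a solution, unique for any basis chosen, and the output is forced (`decodes_add_combine`).

For the probability, each vector of rank `r` arises from equally many pairs `(ε, E')` with `ε`
independent (`card_combine_eq`). Full rank of the block matrix already makes the rows of `E'`
independent, so `E'` may range over all matrices, and the probability is at least the product of
those of the two conditions (`mul_le_prob_vecRank`). A union bound over linear relations estimates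
the condition on `ε` (`card_not_expands_le`). -/

/-! ### Intersection steps on spans of products -/

/-- The span of an intersection of two subfamilies of a linearly independent family. -/
theorem span_image_inf_of_linearIndepOn {ι R M : Type*} [Ring R] [AddCommGroup M] [Module R M]
    {v : ι → M} {u s t : Set ι} (hv : LinearIndepOn R v u) (hs : s ⊆ u) (ht : t ⊆ u) :
    Submodule.span R (v '' s) ⊓ Submodule.span R (v '' t) = Submodule.span R (v '' (s ∩ t)) := by
  apply le_antisymm
  · rintro x ⟨hx, hy⟩
    rw [SetLike.mem_coe, Finsupp.mem_span_image_iff_linearCombination] at hx hy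
    obtain ⟨f, hf, rfl⟩ := hx
    obtain ⟨g, hg, hfg⟩ := hy
    have h := linearIndepOn_iffₛ.1 hv g (Finsupp.supported_mono ht hg) f
      (Finsupp.supported_mono hs hf) hfg
    subst h
    rw [Finsupp.mem_span_image_iff_linearCombination]
    refine ⟨g, ?_, rfl⟩
    rw [Finsupp.mem_supported] at *
    exact Set.subset_inter hf hg
  · exact le_inf (Submodule.span_mono (Set.image_mono Set.inter_subset_left))
      (Submodule.span_mono (Set.image_mono Set.inter_subset_right))

variable {F K : Type*} [Field F] [Field K] [Algebra F K]

/-- The products of the powers of `α` with the entries of `ε`. -/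
def powMul {r : ℕ} (α : K) (ε : Fin r → K) (p : ℕ × Fin r) : K := α ^ p.1 * ε p.2

/-- The span of the products of the entries of `ε` with the powers of `α` with exponent in `T`. -/
def powSpan (F : Type*) {K : Type*} [Field F] [Field K] [Algebra F K] {r : ℕ}
    (α : K) (ε : Fin r → K) (T : Set ℕ) : Submodule F K :=
  Submodule.span F (powMul α ε '' {p | p.1 ∈ T})

theorem boundedDegree_mul_span {r : ℕ} (α : K) (ε : Fin r → K) (j : ℕ) :
    boundedDegree F α j * Submodule.span F (Set.range ε) = powSpan F α ε (Set.Iio j) := by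
  rw [boundedDegree, Submodule.span_mul_span, powSpan]
  congr 1
  ext x
  simp only [Set.mem_mul, Set.mem_range, Set.mem_image, Set.mem_ofPred_eq, Set.mem_Iio, powMul]
  constructor
  · rintro ⟨_, ⟨a, rfl⟩, _, ⟨u, rfl⟩, rfl⟩
    exact ⟨(a, u), a.2, rfl⟩
  · rintro ⟨⟨a, u⟩, ha, rfl⟩
    exact ⟨_, ⟨⟨a, ha⟩, rfl⟩, _, ⟨u, rfl⟩, rfl⟩

theorem powSpan_Iio_one {r : ℕ} (α : K) (ε : Fin r → K) :
    powSpan F α ε (Set.Iio 1) = Submodule.span F (Set.range ε) := by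
  rw [← boundedDegree_mul_span, boundedDegree]
  simp [Set.range_unique, ← Submodule.one_eq_span]

theorem map_mulLeft_powSpan {r : ℕ} (α : K) (ε : Fin r → K) (T : Set ℕ) :
    (powSpan F α ε T).map (LinearMap.mulLeft F α) = powSpan F α ε (Nat.succ '' T) := by
  rw [powSpan, Submodule.map_span, powSpan]
  congr 1
  ext x
  simp only [Set.mem_image, Set.mem_ofPred_eq, powMul, LinearMap.mulLeft_apply]
  constructor
  · rintro ⟨_, ⟨p, hp, rfl⟩, rfl⟩
    exact ⟨(p.1 + 1, p.2), ⟨_, hp, rfl⟩, by ring⟩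
  · rintro ⟨p, ⟨a, ha, hp⟩, rfl⟩
    exact ⟨_, ⟨(a, p.2), ha, rfl⟩, by simp only [← hp, Nat.succ_eq_add_one]; ring⟩

theorem powSpan_mono {r : ℕ} (α : K) (ε : Fin r → K) {S T : Set ℕ} (h : S ⊆ T) :
    powSpan F α ε S ≤ powSpan F α ε T :=
  Submodule.span_mono (Set.image_mono fun _ hp => h hp)

/-- After multiplication by `α`, the step intersects the spans for exponents `0, …, j` and `1, …, j
+ 1`. Independence must reach exponent `j + 1`, hence `j + 2 ≤ D`; this is why `d + t` powers are
required although the expanded support involves only `d + t - 1`. -/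
theorem interStep_powSpan {r D j : ℕ} {α : K} (hα : α ≠ 0) {ε : Fin r → K}
    (hε : LinearIndepOn F (powMul α ε) {p | p.1 < D}) (hj : j + 2 ≤ D) :
    interStep α (powSpan F α ε (Set.Iio (j + 1))) = powSpan F α ε (Set.Iio j) := by
  apply le_antisymm
  · rintro x ⟨⟨w, hw, rfl⟩, hx⟩
    rw [LinearMap.mulLeft_apply] at hx ⊢
    have hx' : w ∈ powSpan F α ε (Nat.succ '' Set.Iio (j + 1)) := by
      rw [← map_mulLeft_powSpan]
      exact ⟨_, hx, by simp [hα]⟩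
    have h := span_image_inf_of_linearIndepOn hε
      (s := {p | p.1 ∈ Set.Iio (j + 1)}) (t := {p | p.1 ∈ Nat.succ '' Set.Iio (j + 1)})
      (fun p hp => by simp at hp ⊢; omega)
      (fun p hp => by obtain ⟨a, ha, hp⟩ := hp; simp at ha hp ⊢; omega)
    have hw' : w ∈ powSpan F α ε (Nat.succ '' Set.Iio j) := by
      have := h.le ⟨hw, hx'⟩
      refine Submodule.span_mono (Set.image_mono ?_) this
      rintro p ⟨hp, a, ha, hpa⟩
      refine ⟨a, ?_, hpa⟩
      simp at hp hpa ⊢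
      omega
    rw [← map_mulLeft_powSpan] at hw'
    obtain ⟨z, hz, rfl⟩ := hw'
    simpa [hα] using hz
  · refine le_inf ?_ (powSpan_mono α ε (Set.Iio_subset_Iio (Nat.le_succ j)))
    intro x hx
    refine ⟨α * x, ?_, by simp [hα]⟩
    have : α * x ∈ (powSpan F α ε (Set.Iio j)).map (LinearMap.mulLeft F α) := ⟨x, hx, rfl⟩
    rw [map_mulLeft_powSpan] at this
    refine powSpan_mono α ε ?_ this
    rintro _ ⟨a, ha, rfl⟩
    simpa using ha

theorem iterate_interStep_powSpan {r D : ℕ} {α : K} (hα : α ≠ 0) {ε : Fin r → K}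
    (hε : LinearIndepOn F (powMul α ε) {p | p.1 < D}) (i j : ℕ) (hij : i + j + 1 ≤ D) :
    (interStep α)^[i] (powSpan F α ε (Set.Iio (i + j))) = powSpan F α ε (Set.Iio j) := by
  induction i with
  | zero => simp
  | succ i ih =>
    rw [Function.iterate_succ_apply, show i + 1 + j = i + j + 1 by omega,
      interStep_powSpan hα hε (by omega), ih (by omega)]

/-! ### The syndrome and the block matrix -/

/-- The vector `ε E'`. -/
def combine {r n : ℕ} (ε : Fin r → K) (E' : Matrix (Fin r) (Fin n) F) (j : Fin n) : K :=
  ∑ u, E' u j • ε u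

theorem mulVec_combine {l n d r : ℕ} {α : K} {H : Matrix (Fin l) (Fin n) K}
    {Hext : Matrix (Fin l × Fin d) (Fin n) F} (hExt : IsExpansion α H Hext)
    (ε : Fin r → K) (E' : Matrix (Fin r) (Fin n) F) (i : Fin l) :
    (H *ᵥ combine ε E') i =
      ∑ u, ∑ v : Fin d, syndromeCoeff Hext E' v i u • (ε u * α ^ (v : ℕ)) := by
  simp only [Matrix.mulVec, dotProduct, combine, hExt i, syndromeCoeff, Matrix.mul_apply,
    Matrix.of_apply, Matrix.transpose_apply, Finset.mul_sum, Finset.sum_smul]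
  simp only [Finset.sum_mul]
  rw [Finset.sum_comm]
  refine Finset.sum_congr rfl fun u _ => ?_
  rw [Finset.sum_comm]
  refine Finset.sum_congr rfl fun v _ => Finset.sum_congr rfl fun j _ => ?_
  rw [smul_mul_smul_comm, mul_comm (ε u)]

/-- Multiplication by `α ^ a` raises every exponent by `a`, which is the shift of the `a`-th block
row. -/
theorem pow_mul_mulVec_combine {l n d r t : ℕ} {α : K} {H : Matrix (Fin l) (Fin n) K}
    {Hext : Matrix (Fin l × Fin d) (Fin n) F} (hExt : IsExpansion α H Hext)
    (ε : Fin r → K) (E' : Matrix (Fin r) (Fin n) F) (p : Fin t × Fin l) :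
    α ^ (p.1 : ℕ) * (H *ᵥ combine ε E') p.2 =
      ∑ c : Fin (d + t - 1) × Fin r,
        blockToeplitz t (syndromeCoeff Hext E') p c • powMul α ε (c.1, c.2) := by
  rw [mulVec_combine hExt, Fintype.sum_prod_type_right, Finset.mul_sum]
  refine Finset.sum_congr rfl fun u _ => ?_
  rw [Finset.mul_sum]
  have hp := p.1.2
  have hlt (v : Fin d) : (p.1 : ℕ) + v < d + t - 1 := by omega
  symm
  -- Only the `d` columns `p.1 + v` carry nonzero blocks.
  refine Finset.sum_of_injOn (fun v : Fin d => (⟨p.1 + v, hlt v⟩ : Fin (d + t - 1)))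
    ?_ (fun _ _ => Finset.mem_coe.2 (Finset.mem_univ _)) ?_ ?_ |>.symm
  · intro v _ w _ h
    simpa [Fin.ext_iff] using h
  · intro b _ hb
    rw [blockToeplitz, dif_neg, zero_smul]
    rintro ⟨h1, h2⟩
    exact hb ⟨⟨b - p.1, h2⟩, by simp, Fin.ext (Nat.add_sub_cancel' h1)⟩
  · intro v _
    have h : (p.1 : ℕ) ≤ p.1 + v ∧ (p.1 : ℕ) + v - p.1 < d := ⟨by omega, by simp⟩
    have hX : blockToeplitz t (syndromeCoeff Hext E') p (⟨p.1 + v, hlt v⟩, u) =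
        syndromeCoeff Hext E' v p.2 u := by
      rw [blockToeplitz, dif_pos h]
      simp only [Nat.add_sub_cancel_left, Fin.eta]
    rw [hX, powMul, mul_smul_comm, pow_add]
    congr 1
    ring

theorem exists_leftInverse_of_rank_eq {m n : Type*} [Fintype m] [Fintype n] [DecidableEq m]
    [DecidableEq n]
    (M : Matrix m n F) (h : M.rank = Fintype.card n) : ∃ L : Matrix n m F, L * M = 1 := by
  have hk : LinearMap.ker M.mulVecLin = ⊥ := by
    rw [Matrix.rank] at h
    have := M.mulVecLin.finrank_range_add_finrank_ker
    rw [h, Module.finrank_fintype_fun_eq_card] at this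
    exact Submodule.finrank_eq_zero.1 (by omega)
  obtain ⟨g, hg⟩ := M.mulVecLin.exists_leftInverse_of_injective hk
  refine ⟨LinearMap.toMatrix' g, ?_⟩
  have := congrArg LinearMap.toMatrix' hg
  rwa [LinearMap.toMatrix'_comp, ← Matrix.toLin'_apply', LinearMap.toMatrix'_toLin',
    LinearMap.toMatrix'_id] at this

/-- If the block matrix has full column rank, the expanded syndrome support is as large as it can
be. -/
theorem boundedDegree_mul_supp {l n d r t : ℕ} {α : K} {H : Matrix (Fin l) (Fin n) K}
    {Hext : Matrix (Fin l × Fin d) (Fin n) F} (hExt : IsExpansion α H Hext)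
    (ε : Fin r → K) (E' : Matrix (Fin r) (Fin n) F)
    (hM : (blockToeplitz t (syndromeCoeff Hext E')).rank = r * (d + t - 1)) :
    boundedDegree F α t * supp (H *ᵥ combine ε E') = powSpan F α ε (Set.Iio (d + t - 1)) := by
  apply le_antisymm
  · rw [boundedDegree, supp, Submodule.span_mul_span, Submodule.span_le]
    rintro _ ⟨_, ⟨a, rfl⟩, _, ⟨i, rfl⟩, rfl⟩
    have := pow_mul_mulVec_combine (t := t) hExt ε E' (a, i)
    simp only [SetLike.mem_coe] at this ⊢
    rw [this]
    exact Submodule.sum_mem _ fun c _ => Submodule.smul_mem _ _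
      (Submodule.subset_span ⟨_, c.1.2, rfl⟩)
  · obtain ⟨L, hL⟩ := exists_leftInverse_of_rank_eq _
      (hM.trans (by simp [mul_comm] :
        r * (d + t - 1) = Fintype.card (Fin (d + t - 1) × Fin r)))
    rw [powSpan, Submodule.span_le]
    rintro _ ⟨⟨b, u⟩, hb, rfl⟩
    -- Row `(b, u)` of the left inverse recovers `α ^ b * ε u` from the multiples of the syndrome.
    have key : powMul α ε (b, u) = ∑ p : Fin t × Fin l, L (⟨b, hb⟩, u) p •
        (α ^ (p.1 : ℕ) * (H *ᵥ combine ε E') p.2) := by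
      simp only [pow_mul_mulVec_combine (t := t) hExt ε E', Finset.smul_sum, smul_smul]
      rw [Finset.sum_comm]
      simp only [← Finset.sum_smul, ← Matrix.mul_apply, hL, Matrix.one_apply]
      simp
    rw [key]
    exact Submodule.sum_mem _ fun p _ => Submodule.smul_mem _ _ (Submodule.mul_mem_mul
      (Submodule.subset_span ⟨p.1, rfl⟩) (Submodule.subset_span ⟨p.2, rfl⟩))

/-! ### Expanding tuples and correctness of the algorithm -/

/-- The products `α ^ b * ε u` with `b < D` are linearly independent. -/
def Expands (F : Type*) {K : Type*} [Field F] [Field K] [Algebra F K] {r : ℕ}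
    (α : K) (ε : Fin r → K) (D : ℕ) : Prop :=
  LinearIndependent F fun p : Fin D × Fin r => powMul α ε (p.1, p.2)

theorem span_range_powMul {r : ℕ} (α : K) (ε : Fin r → K) (D : ℕ) :
    Submodule.span F (Set.range fun p : Fin D × Fin r => powMul α ε (p.1, p.2)) =
      powSpan F α ε (Set.Iio D) := by
  rw [powSpan]
  congr 1
  ext x
  constructor
  · rintro ⟨p, rfl⟩
    exact ⟨(p.1, p.2), p.1.2, rfl⟩
  · rintro ⟨p, hp, rfl⟩
    exact ⟨(⟨p.1, hp⟩, p.2), rfl⟩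

theorem Expands.linearIndepOn {r D : ℕ} {α : K} {ε : Fin r → K} (h : Expands F α ε D) :
    LinearIndepOn F (powMul α ε) {p | p.1 < D} := by
  refine LinearIndependent.comp h
    (fun p : {p : ℕ × Fin r | p.1 < D} => ((⟨p.1.1, p.2⟩, p.1.2) : Fin D × Fin r)) ?_
  intro p q hpq
  simp only [Prod.mk.injEq, Fin.mk.injEq] at hpq
  exact Subtype.ext (Prod.ext hpq.1 hpq.2)

theorem Expands.mono {r D D' : ℕ} {α : K} {ε : Fin r → K} (h : Expands F α ε D) (hD : D' ≤ D) :
    Expands F α ε D' := by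
  refine LinearIndependent.comp h
    (fun p : Fin D' × Fin r => (Fin.castLE hD p.1, p.2)) ?_
  intro p q hpq
  simp only [Prod.mk.injEq, Fin.castLE_inj] at hpq
  exact Prod.ext hpq.1 hpq.2

theorem Expands.linearIndependent {r D : ℕ} {α : K} {ε : Fin r → K} (h : Expands F α ε D)
    (hD : 0 < D) : LinearIndependent F ε := by
  have := LinearIndependent.comp h (fun u : Fin r => ((⟨0, hD⟩, u) : Fin D × Fin r))
    (fun u v huv => (Prod.ext_iff.1 huv).2)
  simpa [powMul, Function.comp_def] using this

theorem Expands.ne_zero {r D : ℕ} {α : K} {ε : Fin r → K} (h : Expands F α ε D)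
    (hD : 1 < D) (hr : 0 < r) : α ≠ 0 := by
  rintro rfl
  exact LinearIndependent.ne_zero ((⟨1, hD⟩, ⟨0, hr⟩) : Fin D × Fin r) h (by simp [powMul])

/-- Expansion is a dimension condition on `boundedDegree F α D` times the span of `ε`, so it does
not depend on the basis. It thus passes to whichever basis the algorithm picks. -/
theorem Expands.of_span_eq {r ρ D : ℕ} {α : K} {ε : Fin r → K} {ε' : Fin ρ → K}
    (h : Expands F α ε D) (hD : 0 < D) (hε' : LinearIndependent F ε')
    (hs : Submodule.span F (Set.range ε') = Submodule.span F (Set.range ε)) :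
    Expands F α ε' D := by
  have h1 := finrank_span_eq_card (h.linearIndependent hD)
  have h2 := finrank_span_eq_card hε'
  have h3 := linearIndependent_iff_card_eq_finrank_span.1 h
  rw [Expands, linearIndependent_iff_card_eq_finrank_span]
  rw [hs] at h2
  rw [Set.finrank, span_range_powMul, ← boundedDegree_mul_span] at h3 ⊢
  rw [hs, ← h3]
  simp only [Fintype.card_fin, Fintype.card_prod] at h1 h2 ⊢
  rw [← h1, h2]

theorem recoveredSupport_mulVec_combine {l n d r t : ℕ} (hd : 0 < d) (ht : 0 < t) (hr : 0 < r)
    {α : K} {H : Matrix (Fin l) (Fin n) K}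
    {Hext : Matrix (Fin l × Fin d) (Fin n) F} (hExt : IsExpansion α H Hext)
    {ε : Fin r → K} (hε : Expands F α ε (d + t)) {E' : Matrix (Fin r) (Fin n) F}
    (hM : (blockToeplitz t (syndromeCoeff Hext E')).rank = r * (d + t - 1)) :
    recoveredSupport F α d t (H *ᵥ combine ε E') = Submodule.span F (Set.range ε) := by
  rw [recoveredSupport, boundedDegree_mul_supp hExt ε E' hM, ← powSpan_Iio_one (F := F) α ε,
    ← iterate_interStep_powSpan (hε.ne_zero (by omega) hr) hε.linearIndepOn (d + t - 2) 1
      (by omega), show d + t - 2 + 1 = d + t - 1 by omega]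

theorem isSyndromeDecomposition_combine {l n d ρ : ℕ} {α : K} {H : Matrix (Fin l) (Fin n) K}
    {Hext : Matrix (Fin l × Fin d) (Fin n) F} (hExt : IsExpansion α H Hext)
    (ε : Fin ρ → K) (x : Fin n → Fin ρ → F) :
    IsSyndromeDecomposition α (H *ᵥ fun j => ∑ u, x j u • ε u) ε
      (fun i u v => (Hext *ᵥ fun j => x j u) (i, v)) :=
  fun i => mulVec_combine hExt ε (Matrix.of fun u j => x j u) i

theorem IsSyndromeDecomposition.unique {l d ρ : ℕ} {α : K} {s : Fin l → K} {ε : Fin ρ → K}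
    (hε : Expands F α ε d) {σ τ : Fin l → Fin ρ → Fin d → F}
    (hσ : IsSyndromeDecomposition α s ε σ) (hτ : IsSyndromeDecomposition α s ε τ) : σ = τ := by
  funext i u v
  have h := (hσ i).symm.trans (hτ i)
  rw [← sub_eq_zero, ← Finset.sum_sub_distrib] at h
  simp only [← Finset.sum_sub_distrib, ← sub_smul] at h
  have h' := Fintype.linearIndependent_iff.1 hε (fun p => σ i p.2 p.1 - τ i p.2 p.1)
    (by rw [Fintype.sum_prod_type_right]; simpa only [powMul, mul_comm (α ^ _)] using h) (v, u)
  exact sub_eq_zero.1 h'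

theorem IsErasureSolution.unique {l n d ρ : ℕ} {Hext : Matrix (Fin l × Fin d) (Fin n) F}
    (hcols : LinearIndependent F Hext.col) {σ : Fin l → Fin ρ → Fin d → F}
    {x y : Fin n → Fin ρ → F} (hx : IsErasureSolution Hext σ x)
    (hy : IsErasureSolution Hext σ y) : x = y := by
  funext j u
  exact congrFun (Matrix.mulVec_injective_iff.2 hcols ((hx u).trans (hy u).symm)) j

/-- The algorithm corrects the error `ε E'` if `ε` expands and the block matrix of `E'` has full
column rank. -/
theorem decodes_add_combine {l n d r t : ℕ} (hd : 0 < d) (ht : 0 < t) (hr : 0 < r)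
    {α : K} {H : Matrix (Fin l) (Fin n) K}
    {Hext : Matrix (Fin l × Fin d) (Fin n) F} (hExt : IsExpansion α H Hext)
    (hcols : LinearIndependent F Hext.col) {c : Fin n → K} (hc : c ∈ code H)
    {ε : Fin r → K} (hε : Expands F α ε (d + t)) {E' : Matrix (Fin r) (Fin n) F}
    (hM : (blockToeplitz t (syndromeCoeff Hext E')).rank = r * (d + t - 1)) :
    Decodes α H Hext t (c + combine ε E') c := by
  have hsyn : H *ᵥ (c + combine ε E') = H *ᵥ combine ε E' := by
    have hc' : H *ᵥ c = 0 := hc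
    rw [Matrix.mulVec_add, hc', zero_add]
  have hrec := recoveredSupport_mulVec_combine hd ht hr hExt hε hM
  rw [← hsyn] at hrec
  have hE : recoveredSupport F α d t (H *ᵥ (c + combine ε E')) ≠ ⊥ := by
    rw [hrec]
    intro h
    exact (hε.linearIndependent (by omega)).ne_zero ⟨0, hr⟩
      ((Submodule.mem_bot F).1 (h ▸ Submodule.subset_span ⟨_, rfl⟩))
  have hs : H *ᵥ (c + combine ε E') ≠ 0 := by
    intro h0
    have h := boundedDegree_mul_supp hExt ε E' hM
    rw [← hsyn, h0] at h
    have hz : powMul α ε (0, ⟨0, hr⟩) ∈ powSpan F α ε (Set.Iio (d + t - 1)) :=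
      Submodule.subset_span ⟨_, by simp; omega, rfl⟩
    rw [← h, supp, Submodule.span_eq_bot.2 (by simp), Submodule.mul_bot,
      Submodule.mem_bot] at hz
    exact (hε.linearIndependent (by omega)).ne_zero ⟨0, hr⟩ (by simpa [powMul] using hz)
  -- The recovered support contains all coordinates of the error, so the error has coefficients in
  -- any of its bases; these solve both linear systems.
  have hcoord {ρ : ℕ}
      (b : Module.Basis (Fin ρ) F (recoveredSupport F α d t (H *ᵥ (c + combine ε E')))) :
      ∃ x : Fin n → Fin ρ → F, combine ε E' = fun j => ∑ u, x j u • (b u : K) := by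
    have hmem (j : Fin n) :
        combine ε E' j ∈ recoveredSupport F α d t (H *ᵥ (c + combine ε E')) := by
      rw [hrec]
      exact Submodule.sum_mem _ fun u _ => Submodule.smul_mem _ _ (Submodule.subset_span ⟨u, rfl⟩)
    refine ⟨fun j u => b.repr ⟨_, hmem j⟩ u, funext fun j => ?_⟩
    have := congrArg Subtype.val (b.sum_repr ⟨_, hmem j⟩)
    rw [Submodule.coe_sum] at this
    exact this.symm
  have hdec {ρ : ℕ} (b : Fin ρ → K) (x : Fin n → Fin ρ → F)
      (hx : combine ε E' = fun j => ∑ u, x j u • b u) :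
      IsSyndromeDecomposition α (H *ᵥ (c + combine ε E')) b
        (fun i u v => (Hext *ᵥ fun j => x j u) (i, v)) := by
    rw [hsyn, hx]
    exact isSyndromeDecomposition_combine hExt b x
  have hexp {ρ : ℕ}
      (b : Module.Basis (Fin ρ) F (recoveredSupport F α d t (H *ᵥ (c + combine ε E')))) :
      Expands F α (fun u => (b u : K)) d := by
    refine (hε.of_span_eq (by omega) (b.linearIndependent.map' (Submodule.subtype _)
      (Submodule.ker_subtype _)) ?_).mono (by omega)
    rw [Set.range_comp, ← Submodule.map_span, b.span_eq, Submodule.map_subtype_top, hrec]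
  intro o
  constructor
  · rintro (h | ⟨_, h⟩ | ⟨_, _, b, h⟩ | ⟨_, _, b, σ, hσ, h⟩ | ⟨_, _, b, σ, hσ, y, hy⟩)
    · exact absurd h hs
    · exact absurd h hE
    · obtain ⟨x, hx⟩ := hcoord b
      exact absurd ⟨_, hdec _ x hx⟩ h
    · obtain ⟨x, hx⟩ := hcoord b
      obtain rfl := hσ.unique (hexp b) (hdec _ x hx)
      exact absurd ⟨x, fun u => rfl⟩ h
    · obtain ⟨x, hx⟩ := hcoord b
      obtain rfl := hσ.unique (hexp b) (hdec _ x hx)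
      obtain rfl := IsErasureSolution.unique hcols hy (y := x) (fun u => rfl)
      rw [← hx, add_sub_cancel_right]
  -- `Decodes` also demands that some run return `c`, so an actual run is exhibited.
  · rintro rfl
    have : FiniteDimensional F (recoveredSupport F α d t (H *ᵥ (c + combine ε E'))) := by
      rw [hrec]
      exact FiniteDimensional.span_of_finite F (Set.finite_range ε)
    let b := Module.finBasis F (recoveredSupport F α d t (H *ᵥ (c + combine ε E')))
    obtain ⟨x, hx⟩ := hcoord b
    have h := Returns.decoded hs hE b _ (hdec _ x hx) x (fun u => rfl)
    rwa [← hx, add_sub_cancel_right] at h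

/-! ### Counting -/

/-- A full-rank block matrix forces the rows of `E'` to be linearly independent. -/
theorem linearIndependent_row_of_rank_blockToeplitz {l n d r t : ℕ} (hd : 0 < d) (ht : 0 < t)
    (Hext : Matrix (Fin l × Fin d) (Fin n) F) (E' : Matrix (Fin r) (Fin n) F)
    (hM : (blockToeplitz t (syndromeCoeff Hext E')).rank = r * (d + t - 1)) :
    LinearIndependent F E'.row := by
  obtain ⟨L, hL⟩ := exists_leftInverse_of_rank_eq _
    (hM.trans (by simp [mul_comm] : r * (d + t - 1) = Fintype.card (Fin (d + t - 1) × Fin r)))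
  rw [← Matrix.vecMul_injective_iff, ← Matrix.coe_vecMulLinear, ← LinearMap.ker_eq_bot,
    LinearMap.ker_eq_bot']
  intro w hw
  rw [Matrix.vecMulLinear_apply] at hw
  have hX (v : Fin d) : syndromeCoeff Hext E' v *ᵥ w = 0 := by
    rw [syndromeCoeff, ← Matrix.mulVec_mulVec, Matrix.mulVec_transpose, hw, Matrix.mulVec_zero]
  -- A relation `w` among the rows of `E'` is killed by every coefficient matrix, so `w` placed in
  -- block column `0` lies in the kernel of the block matrix.
  let b : Fin (d + t - 1) := ⟨0, by omega⟩
  let W : Fin (d + t - 1) × Fin r → F := fun c => if c.1 = b then w c.2 else 0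
  have hW : blockToeplitz t (syndromeCoeff Hext E') *ᵥ W = 0 := by
    funext p
    rw [Matrix.mulVec, dotProduct, Fintype.sum_prod_type, Finset.sum_eq_single b]
    · simp only [W, if_true, blockToeplitz, Pi.zero_apply]
      split_ifs with h
      · exact congrFun (hX ⟨_, h.2⟩) p.2
      · simp
    · intro c _ hc
      simp [W, hc]
    · simp
  have h0 : W = 0 := by
    rw [← Matrix.one_mulVec W, ← hL, ← Matrix.mulVec_mulVec, hW, Matrix.mulVec_zero]
  funext u
  simpa [W] using congrFun h0 (b, u)

theorem supp_combine_le {r n : ℕ} (ε : Fin r → K) (E' : Matrix (Fin r) (Fin n) F) :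
    supp (F := F) (combine ε E') ≤ Submodule.span F (Set.range ε) := by
  rw [supp, Submodule.span_le]
  rintro _ ⟨j, rfl⟩
  exact Submodule.sum_mem _ fun u _ => Submodule.smul_mem _ _ (Submodule.subset_span ⟨u, rfl⟩)

theorem supp_combine {r n : ℕ} (ε : Fin r → K) {E' : Matrix (Fin r) (Fin n) F}
    (hE' : LinearIndependent F E'.row) :
    supp (F := F) (combine ε E') = Submodule.span F (Set.range ε) := by
  refine le_antisymm (supp_combine_le ε E') (Submodule.span_le.2 ?_)
  obtain ⟨L, hL⟩ := exists_leftInverse_of_rank_eq E'ᵀ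
    (by rw [Matrix.rank_transpose, hE'.rank_matrix])
  rintro _ ⟨u, rfl⟩
  have : ε u = ∑ j, L u j • combine ε E' j := by
    simp only [combine, Finset.smul_sum, smul_smul]
    rw [Finset.sum_comm]
    simp only [← Finset.sum_smul]
    have h (w : Fin r) : ∑ j, L u j * E' w j = (1 : Matrix (Fin r) (Fin r) F) u w := by
      rw [← hL, Matrix.mul_apply]; rfl
    simp [h, Matrix.one_apply]
  rw [this]
  exact Submodule.sum_mem _ fun j _ => Submodule.smul_mem _ _ (Submodule.subset_span ⟨j, rfl⟩)

theorem vecRank_combine {r n : ℕ} {ε : Fin r → K} (hε : LinearIndependent F ε)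
    {E' : Matrix (Fin r) (Fin n) F} (hE' : LinearIndependent F E'.row) :
    vecRank F (combine ε E') = r := by
  rw [vecRank, supp_combine ε hE', finrank_span_eq_card hε, Fintype.card_fin]

theorem combine_injective {r n : ℕ} {ε : Fin r → K} (hε : LinearIndependent F ε) :
    Function.Injective (combine ε : Matrix (Fin r) (Fin n) F → Fin n → K) := by
  intro A B h
  ext u j
  have hj := congrFun h j
  rw [combine, combine, ← sub_eq_zero, ← Finset.sum_sub_distrib] at hj
  simp only [← sub_smul] at hj
  exact sub_eq_zero.1 (Fintype.linearIndependent_iff.1 hε _ hj u)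

variable [Fintype F] [Fintype K]

/-! ### Counting factorizations and non-expanding tuples -/

/-- Every vector of rank `r` is `ε E'` for the same number of pairs `(ε, E')` with `ε` linearly
independent. -/
theorem card_combine_eq {r n : ℕ} {e : Fin n → K} (he : vecRank F e = r) :
    Nat.card {p : (Fin r → K) × Matrix (Fin r) (Fin n) F //
      LinearIndependent F p.1 ∧ combine p.1 p.2 = e} =
      ∏ i : Fin r, (Fintype.card F ^ r - Fintype.card F ^ (i : ℕ)) := by
  have : FiniteDimensional F K := Module.Finite.of_finite
  have hcard := card_linearIndependent (K := F) (V := supp (F := F) e) (k := r) he.ge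
  rw [show Module.finrank F (supp (F := F) e) = r from he] at hcard
  rw [← hcard]
  have hspan {ε : Fin r → K} (hε : LinearIndependent F ε) {E' : Matrix (Fin r) (Fin n) F}
      (h : combine ε E' = e) : supp (F := F) e = Submodule.span F (Set.range ε) :=
    Submodule.eq_of_le_of_finrank_eq (h ▸ supp_combine_le ε E')
      (he.trans (by rw [finrank_span_eq_card hε, Fintype.card_fin]))
  -- The pairs correspond to ordered bases `ε` of the support of `e`; the matrix `E'` is then
  -- determined as the coordinates of `e`.
  refine Nat.card_eq_of_bijective
    (fun p => ⟨fun u => ⟨p.1.1 u, ?_⟩, ?_⟩) ⟨?_, ?_⟩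
  · rw [hspan p.2.1 p.2.2]
    exact Submodule.subset_span ⟨u, rfl⟩
  · exact LinearIndependent.of_comp (Submodule.subtype _) p.2.1
  · rintro ⟨⟨ε, A⟩, hε, hA⟩ ⟨⟨ε', B⟩, hε', hB⟩ h
    have hεε : ε = ε' := funext fun u =>
      congrArg Subtype.val (congrFun (congrArg Subtype.val h) u)
    subst hεε
    have := combine_injective hε (hA.trans hB.symm)
    subst this
    rfl
  · rintro ⟨s, hs⟩
    let b := basisOfLinearIndependentOfCardEqFinrank' s hs
      ((Fintype.card_fin r).trans he.symm)
    have hb (u) : b u = s u := by simp [b]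
    refine ⟨⟨(fun u => s u,
      Matrix.of fun u j => b.repr ⟨e j, Submodule.subset_span ⟨j, rfl⟩⟩ u),
      hs.map' (Submodule.subtype _) (Submodule.ker_subtype _), ?_⟩, rfl⟩
    funext j
    have := congrArg Subtype.val (b.sum_repr ⟨e j, Submodule.subset_span ⟨j, rfl⟩⟩)
    rw [Submodule.coe_sum] at this
    simp only [hb] at this
    exact this

open Finset in
open scoped Classical in
theorem card_filter_linearIndependent {m k : ℕ} (hm : Module.finrank F K = m) (hk : k ≤ m) :
    #{ε : Fin k → K | LinearIndependent F ε} =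
      ∏ i : Fin k, (Fintype.card F ^ m - Fintype.card F ^ (i : ℕ)) := by
  have := card_linearIndependent (K := F) (V := K) (k := k) (hm ▸ hk)
  rwa [Nat.card_eq_fintype_card, Fintype.card_subtype, hm] at this

omit [Fintype F] in
open Finset in
open scoped Classical in
/-- The number of linearly independent tuples satisfying a given nontrivial linear relation. -/
theorem card_linearIndependent_relation_le {r : ℕ} {g : Fin (r + 1) → K} (hg : g ≠ 0) :
    #{ε : Fin (r + 1) → K | LinearIndependent F ε ∧ ∑ u, g u * ε u = 0} ≤
      #{ε : Fin r → K | LinearIndependent F ε} := by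
  obtain ⟨i, hi⟩ := Function.ne_iff.1 hg
  -- Since `g i ≠ 0`, the relation determines `ε i` from the remaining entries.
  refine card_le_card_of_injOn (fun ε => ε ∘ i.succAbove) ?_ ?_
  · intro ε hε
    simp only [coe_filter, mem_univ, true_and, Set.mem_ofPred_eq] at hε ⊢
    exact hε.1.comp _ Fin.succAbove_right_injective
  · intro ε hε ε' hε' h
    simp only [coe_filter, mem_univ, true_and, Set.mem_ofPred_eq] at hε hε'
    have h' (u) : ε (i.succAbove u) = ε' (i.succAbove u) := congrFun h u
    have hi' : ε i = ε' i := by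
      have := hε.2.trans hε'.2.symm
      rw [Fin.sum_univ_succAbove _ i, Fin.sum_univ_succAbove _ i] at this
      simp only [h'] at this
      exact mul_left_cancel₀ hi (add_right_cancel this)
    funext u
    rcases Fin.eq_self_or_eq_succAbove i u with rfl | ⟨v, rfl⟩
    · exact hi'
    · exact h' v

open Finset in
open scoped Classical in
-- A dependency `f` among the products is a `K`-linear relation on `ε` with coefficients `g f u = ∑
-- b, f (b, u) • α ^ b`, nontrivial because the powers of `α` are independent. The union bound runs
-- over the at most `q ^ ((r + 1) * D)` choices of `f`, where `q` is the size of `F`.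
theorem card_not_expands_le {r D : ℕ} {α : K}
    (hα : LinearIndependent F fun b : Fin D => α ^ (b : ℕ)) :
    #{ε : Fin (r + 1) → K | LinearIndependent F ε ∧ ¬ Expands F α ε D} ≤
      Fintype.card F ^ ((r + 1) * D) * #{ε : Fin r → K | LinearIndependent F ε} := by
  let g (f : Fin D × Fin (r + 1) → F) (u : Fin (r + 1)) : K := ∑ b, f (b, u) • α ^ (b : ℕ)
  let B (f : Fin D × Fin (r + 1) → F) : Finset (Fin (r + 1) → K) :=
    {ε | LinearIndependent F ε ∧ ∑ u, g f u * ε u = 0}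
  have hsub : ({ε : Fin (r + 1) → K | LinearIndependent F ε ∧ ¬ Expands F α ε D} : Finset _) ⊆
      (univ.erase 0).biUnion B := by
    intro ε hε
    simp only [mem_filter, mem_univ, true_and] at hε
    obtain ⟨hε, hexp⟩ := hε
    rw [Expands, Fintype.not_linearIndependent_iff] at hexp
    obtain ⟨f, hf, p, hp⟩ := hexp
    refine mem_biUnion.2 ⟨f, mem_erase.2 ⟨fun h => hp (congrFun h p), mem_univ _⟩, ?_⟩
    simp only [B, mem_filter, mem_univ, true_and]
    refine ⟨hε, ?_⟩
    rw [← hf, Fintype.sum_prod_type_right]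
    refine sum_congr rfl fun u _ => ?_
    simp only [g, sum_mul, powMul, smul_mul_assoc]
  refine (card_le_card hsub).trans ((card_biUnion_le_card_mul _ _ _ fun f hf => ?_).trans
    (Nat.mul_le_mul_right _ ?_))
  · refine card_linearIndependent_relation_le fun h => (mem_erase.1 hf).1 (funext fun p => ?_)
    exact Fintype.linearIndependent_iff.1 hα _ (congrFun h p.2) p.1
  · refine (card_le_univ _).trans ?_
    simp [mul_comm]

/-! ### From counts to probabilities -/

open Finset in
theorem prob_eq_card_div {Ω : Type*} {S A : Set Ω} {T U : Finset Ω} (hT : ∀ x, x ∈ T ↔ x ∈ S)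
    (hU : ∀ x, x ∈ U ↔ x ∈ S ∧ x ∈ A) : prob S A = (#U : ℝ) / #T := by
  rw [prob, show S = T from Set.ext fun x => (hT x).symm,
    show (T : Set Ω) ∩ A = U from Set.ext fun x => by simp [hT, hU], Set.ncard_coe_finset,
    Set.ncard_coe_finset]

open Finset in
/-- A uniformly random linearly independent tuple expands with high probability. -/
theorem le_prob_expands {m r D : ℕ} (hm : Module.finrank F K = m) (hr : 0 < r) (hrm : r ≤ m)
    {α : K} (hα : LinearIndependent F fun b : Fin D => α ^ (b : ℕ)) :
    1 - (Fintype.card F : ℝ) ^ (r * D) /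
        ((Fintype.card F : ℝ) ^ m - (Fintype.card F : ℝ) ^ (r - 1)) ≤
      prob {ε : Fin r → K | LinearIndependent F ε} {ε | Expands F α ε D} := by
  classical
  rw [prob_eq_card_div (T := {ε : Fin r → K | LinearIndependent F ε})
    (U := {ε : Fin r → K | LinearIndependent F ε ∧ Expands F α ε D}) (by simp) (by simp)]
  obtain ⟨r, rfl⟩ : ∃ s, r = s + 1 := ⟨r - 1, by omega⟩
  have hq : 1 < Fintype.card F := Fintype.one_lt_card
  have hbad := card_not_expands_le (r := r) hα
  have hsplit : #{ε : Fin (r + 1) → K | LinearIndependent F ε ∧ Expands F α ε D} +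
      #{ε : Fin (r + 1) → K | LinearIndependent F ε ∧ ¬ Expands F α ε D} =
      #{ε : Fin (r + 1) → K | LinearIndependent F ε} := by
    rw [← filter_filter, ← filter_filter]
    exact card_filter_add_card_filter_not _
  have hIr := card_filter_linearIndependent (F := F) (k := r) hm (by omega)
  -- The last vector of an independent tuple avoids the span of the others; this factor becomes the
  -- denominator of the bound.
  have hI : #{ε : Fin (r + 1) → K | LinearIndependent F ε} =
      #{ε : Fin r → K | LinearIndependent F ε} * (Fintype.card F ^ m - Fintype.card F ^ r) := by
    rw [hIr, card_filter_linearIndependent hm hrm, Fin.prod_univ_castSucc]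
    rfl
  have hlt : Fintype.card F ^ r < Fintype.card F ^ m := Nat.pow_lt_pow_right hq (by omega)
  have hpos : 0 < #{ε : Fin r → K | LinearIndependent F ε} := by
    rw [hIr]
    exact prod_pos fun i _ => Nat.sub_pos_of_lt (Nat.pow_lt_pow_right hq (by omega))
  generalize #{ε : Fin (r + 1) → K | LinearIndependent F ε ∧ ¬ Expands F α ε D} = b at *
  generalize #{ε : Fin (r + 1) → K | LinearIndependent F ε ∧ Expands F α ε D} = a at *
  generalize #{ε : Fin r → K | LinearIndependent F ε} = L at *
  generalize #{ε : Fin (r + 1) → K | LinearIndependent F ε} = I at *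
  have hIR : (I : ℝ) = L * ((Fintype.card F : ℝ) ^ m - (Fintype.card F : ℝ) ^ r) := by
    rw [hI, Nat.cast_mul, Nat.cast_sub hlt.le]
    push_cast
    rfl
  have hsR : (a : ℝ) + b = I := by exact_mod_cast hsplit
  have hbR : (b : ℝ) ≤ (Fintype.card F : ℝ) ^ ((r + 1) * D) * L := by exact_mod_cast hbad
  have hltR : (0 : ℝ) < (Fintype.card F : ℝ) ^ m - (Fintype.card F : ℝ) ^ r := by
    rw [sub_pos]
    exact_mod_cast hlt
  have hLR : (0 : ℝ) < L := by exact_mod_cast hpos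
  rw [Nat.add_sub_cancel, le_div_iff₀ (by rw [hIR]; positivity), sub_mul, one_mul, ← hsR]
  have : (Fintype.card F : ℝ) ^ ((r + 1) * D) /
      ((Fintype.card F : ℝ) ^ m - (Fintype.card F : ℝ) ^ r) * (a + b) =
      (Fintype.card F : ℝ) ^ ((r + 1) * D) * L := by
    rw [hsR, hIR]
    field_simp
  linarith

open Finset in
theorem card_mul_card_le_of_fiber {X Y Z : Type*} [DecidableEq Z] (I : Finset X) (J : Finset Y)
    (T : Finset Z) (f : X → Y → Z) (N : ℕ) (hf : ∀ x ∈ I, ∀ y ∈ J, f x y ∈ T)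
    (hN : ∀ z ∈ T, #{p ∈ I ×ˢ J | f p.1 p.2 = z} ≤ N) : #I * #J ≤ N * #T := by
  rw [← card_product]
  exact card_le_mul_card_image_of_maps_to
    (fun p hp => hf _ (mem_product.1 hp).1 _ (mem_product.1 hp).2) N hN

open Finset in
theorem card_mul_le_card_mul_of_fiber {X Y Z : Type*} [DecidableEq Z] (I : Finset X)
    (J : Finset Y) (T : Finset Z) (f : X → Y → Z) (N : ℕ)
    (hN : ∀ z ∈ T, N ≤ #{p ∈ I ×ˢ J | f p.1 p.2 = z}) : #T * N ≤ #I * #J := by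
  rw [← card_product, ← smul_eq_mul]
  exact (card_nsmul_le_sum T _ N hN).trans 
    ((sum_card_fiberwise_eq_card_filter _ _ _).trans_le (card_filter_le _ _))

open Finset in
/-- If separate conditions on `ε` and on `E'` ensure that `ε E'` is a vector of rank `r` in `A`, the
probability of `A` among vectors of rank `r` is at least the product of the probabilities of the two
conditions, for `ε` uniform on linearly independent tuples and `E'` uniform on all matrices. -/
theorem mul_le_prob_vecRank {n r : ℕ} (A : Set (Fin n → K))
    (P : (Fin r → K) → Prop) (Q : Matrix (Fin r) (Fin n) F → Prop)
    (hrank : ∀ ε E', P ε → Q E' → vecRank F (combine ε E') = r)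
    (hA : ∀ ε E', P ε → Q E' → combine ε E' ∈ A) :
    prob {ε | LinearIndependent F ε} {ε | P ε} * prob Set.univ {E' | Q E'} ≤
      prob {e : Fin n → K | vecRank F e = r} A := by
  classical
  obtain ⟨N, hN, hfib⟩ : ∃ N : ℕ, 0 < N ∧ ∀ e : Fin n → K, vecRank F e = r →
      #{p : (Fin r → K) × Matrix (Fin r) (Fin n) F |
        LinearIndependent F p.1 ∧ combine p.1 p.2 = e} = N := by
    refine ⟨∏ i : Fin r, (Fintype.card F ^ r - Fintype.card F ^ (i : ℕ)), ?_, fun e he => ?_⟩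
    · exact prod_pos fun i _ =>
        Nat.sub_pos_of_lt (Nat.pow_lt_pow_right Fintype.one_lt_card i.2)
    · rw [← card_combine_eq (F := F) he, Nat.card_eq_fintype_card, Fintype.card_subtype]
  let S : Finset (Fin n → K) := {e | vecRank F e = r}
  let SA : Finset (Fin n → K) := {e | vecRank F e = r ∧ e ∈ A}
  let I : Finset (Fin r → K) := {ε | LinearIndependent F ε}
  let I' : Finset (Fin r → K) := {ε | LinearIndependent F ε ∧ P ε}
  let M : Finset (Matrix (Fin r) (Fin n) F) := univ
  let M' : Finset (Matrix (Fin r) (Fin n) F) := {E' | Q E'}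
  have hfib' (e : Fin n → K) (he : vecRank F e = r) :
      #{p ∈ I ×ˢ M | combine p.1 p.2 = e} = N := by
    rw [← hfib e he]
    congr 1
    ext p
    simp [I, M]
  have hS : #S * N ≤ #I * #M :=
    card_mul_le_card_mul_of_fiber I M S (fun ε E' => combine ε E') N
      fun e he => (hfib' e (mem_filter.1 he).2).ge
  have hG : #I' * #M' ≤ N * #SA := by
    refine card_mul_card_le_of_fiber I' M' SA (fun ε E' => combine ε E') N
      (fun ε h1 E' h2 => ?_) fun e he => ?_
    · have h1 := (mem_filter.1 h1).2.2
      have h2 := (mem_filter.1 h2).2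
      exact mem_filter.2 ⟨mem_univ _, hrank _ _ h1 h2, hA _ _ h1 h2⟩
    · rw [← hfib' e (mem_filter.1 he).2.1]
      refine card_le_card (filter_subset_filter _ (product_subset_product ?_ ?_))
      · exact fun ε h => mem_filter.2 ⟨mem_univ _, (mem_filter.1 h).2.1⟩
      · exact subset_univ _
  have hSA : #SA ≤ #S := card_le_card fun e he =>
    mem_filter.2 ⟨mem_univ _, (mem_filter.1 he).2.1⟩
  have hprob : prob {e : Fin n → K | vecRank F e = r} A = (#SA : ℝ) / #S := 
    prob_eq_card_div (by simp [S]) (by simp [SA])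
  have hprobI : prob {ε | LinearIndependent F ε} {ε | P ε} = (#I' : ℝ) / #I :=
    prob_eq_card_div (by simp [I]) (by simp [I'])
  have hprobM : prob Set.univ {E' | Q E'} = (#M' : ℝ) / #M :=
    prob_eq_card_div (by simp [M]) (by simp [M'])
  rw [hprob, hprobI, hprobM, div_mul_div_comm]
  have hSR : (#S : ℝ) * N ≤ #I * #M := by exact_mod_cast hS
  have hGR : (#I' : ℝ) * #M' ≤ N * #SA := by exact_mod_cast hG
  have hNR : (0 : ℝ) < N := by exact_mod_cast hN
  -- If no vector has rank `r`, the right side is `0 / 0 = 0`; then there are no good pairs either,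
  -- so the left side vanishes too.
  rcases Nat.eq_zero_or_pos #S with h0 | h0
  · have hSA0 : #SA = 0 := by omega
    rw [hSA0, Nat.cast_zero, mul_zero] at hGR
    rw [hSA0, Nat.cast_zero, zero_div]
    exact div_nonpos_of_nonpos_of_nonneg hGR (by positivity)
  · have h0R : (0 : ℝ) < #S := by exact_mod_cast h0
    rw [← mul_div_mul_left (#SA : ℝ) (#S : ℝ) hNR.ne', mul_comm (N : ℝ) (#S : ℝ)]
    exact div_le_div₀ (by positivity) hGR (by positivity) hSR

end BDLRPC

theorem theorem3 {F K : Type*} [Field F] [Fintype F] [Field K] [Fintype K] [Algebra F K]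
    (q m : ℕ) (hq : Fintype.card F = q) (hm : Module.finrank F K = m)
    (α : K) (hα : (minpoly F α).natDegree = m)
    (d k n r t : ℕ) (hd : 0 < d) (hk : 0 < k) (hkn : k < n) (hr : 0 < r) (ht : 0 < t)
    (H : Matrix (Fin (n - k)) (Fin n) K) (hH : BDLRPC.IsBDLRPC F α d H)
    (Hext : Matrix (Fin (n - k) × Fin d) (Fin n) F) (hExt : BDLRPC.IsExpansion α H Hext)
    (hUD : BDLRPC.UniqueDecoding Hext) (hMRS : BDLRPC.MaximalRowSpan F α d H)
    (h1 : r * (d + t - 1) ≤ t * (n - k)) (h2 : (d + t) * r ≤ m)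
    (c : Fin n → K) (hc : c ∈ BDLRPC.code H) :
    (1 - (q : ℝ) ^ (r * (t + d)) / ((q : ℝ) ^ m - (q : ℝ) ^ (r - 1))) *
        BDLRPC.expansionProb Hext r t ≤
      BDLRPC.prob {e : Fin n → K | BDLRPC.vecRank F e = r}
        {e | BDLRPC.Decodes α H Hext t (c + e) c} := by
  subst hq
  have hDm : d + t ≤ m := (Nat.le_mul_of_pos_right _ hr).trans h2
  have hrm : r ≤ m := (Nat.le_mul_of_pos_left _ (by omega)).trans h2
  -- The first `d + t` powers of `α` are independent since `d + t ≤ m`, the degree of `α`.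
  have hpow : LinearIndependent F fun b : Fin (d + t) => α ^ (b : ℕ) :=
    (linearIndependent_pow (K := F) α).comp (Fin.castLE (hα ▸ hDm)) (Fin.castLE_injective _)
  have hbound := BDLRPC.le_prob_expands hm hr hrm hpow
  have hmain := BDLRPC.mul_le_prob_vecRank (n := n) (r := r)
    {e | BDLRPC.Decodes α H Hext t (c + e) c}
    (fun ε => BDLRPC.Expands F α ε (d + t))
    (fun E' => (BDLRPC.blockToeplitz t (BDLRPC.syndromeCoeff Hext E')).rank = r * (d + t - 1))
    (fun ε E' hε hE' => BDLRPC.vecRank_combine (hε.linearIndependent (by omega))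
      (BDLRPC.linearIndependent_row_of_rank_blockToeplitz hd ht Hext E' hE'))
    (fun ε E' hε hE' => BDLRPC.decodes_add_combine hd ht hr hExt hUD.cols_indep hc hε hE')
  rw [add_comm t d]
  -- Only the sign of `expansionProb` matters here; the other factor may be negative.
  exact (mul_le_mul_of_nonneg_right hbound
    (div_nonneg (Nat.cast_nonneg _) (Nat.cast_nonneg _))).trans hmain
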